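/- Let $\mathbb{K}$ be a field and $C$ a $\mathbb{K}$-coalgebra. For a unital $\mathbb{K}$-algebra $A$ that is also a right $C$-comodule with coaction $\rho(a)=a_{(0)}\otimes a_{(1)}$, let $A^{\mathrm{co}\,C}=\{b\in A : \rho(ba)=b\rho(a)\ \text{for all } a\in A\}$ be its subalgebra of coinvariants. One says that $A$ is a $C$-coalgebra Galois extension of $A^{\mathrm{co}\,C}$ if the canonical map $A\otimes_{A^{\mathrm{co}\,C}}A\to A\otimes C$, $a\otimes a'\mapsto aa'_{(0)}\otimes a'_{(1)}$, is bijective. A cleaving map on $A$ is a right $C$-colinear map $\gamma:C\to A$ that is invertible for the convolution product; its convolution inverse is $\gamma^{-1}$. Let $P$ be a unital $\mathbb{K}$-algebra and a right $C$-comodule, let $B=P^{\mathrm{co}\,C}$, and let $J_1,J_2$ be two-sided ideals of $P$ that are also right $C$-subcomodules. Put $P_i=P/J_i$ and $P_{12}=P/(J_1+J_2)$ with the induced algebra and comodule structures. Assume that $(P,(J_1,J_2))$ is a locally $C$-coalgebra Galois extension, i.e. * $(J_1,J_2)$ is a complete covering of $P$: $J_1\cap J_2=0$, and every pair $(p_1,p_2)\in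 P_1\times P_2$ whose components have the same image in $P_{12}$ comes from an element of $P$; * for $i=1,2$, the image of $B$ in $P_i$ equals $P_i^{\mathrm{co}\,C}$, and $P_i$ is a $C$-coalgebra Galois extension of $P_i^{\mathrm{co}\,C}$; * the image of $B$ in $P_{12}$ equals $P_{12}^{\mathrm{co}\,C}$. Let $\gamma_i:C\to P_i$ ($i=1,2$) be cleaving maps, so that the extension is locally cleft. Let $B_i=B/(B\cap J_i)$, identified with the image of $B$ in $P_i$, and let $\pi^2_1:B_2\to B/(B\cap J_1+B\cap J_2)$ be the canonical surjection. Assume that the locally cleft extension is regular, i.e. for $i=1,2$ the element $1_{(0)}\gamma_i^{-1}(1_{(1)})$ of $P_i$ has a right inverse in $B_i$, and that $$\gamma_2(C)\,\ker(\pi^2_1)=\ker(\pi^2_1)\,\gamma_2(C)$$ as subspaces of $P_2$, where the product of two subspaces is the linear span of all products of their elements. Then $P$ is a $C$-coalgebra Galois extension of $B$. -/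

import Mathlib

open scoped TensorProduct

noncomputable section

/-- A right `C`-comodule structure on the `K`-module `M`. -/
structure RightCoaction (K C M : Type*) [CommRing K] [AddCommGroup C] [Module K C] [Coalgebra K C]
    [AddCommGroup M] [Module K M] where
  /-- the coaction, `m ↦ m₍₀₎ ⊗ m₍₁₎` -/
  coact : M →ₗ[K] M ⊗[K] C
  coassoc : (TensorProduct.assoc K M C C).toLinearMap ∘ₗ coact.rTensor C ∘ₗ coact =
    (Coalgebra.comul (R := K) (A := C)).lTensor M ∘ₗ coact
  counit_coact : (TensorProduct.rid K M).toLinearMap ∘ₗ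
    (Coalgebra.counit (R := K) (A := C)).lTensor M ∘ₗ coact = LinearMap.id

/-- The span in `P ⊗_K P` of all `p b ⊗ q - p ⊗ b q` with `b` in the subalgebra `B`. -/
abbrev balancedRelations {K P : Type*} [CommRing K] [Ring P] [Algebra K P] (B : Subalgebra K P) :
    Submodule K (P ⊗[K] P) :=
  Submodule.span K {x | ∃ p : P, ∃ b ∈ B, ∃ q : P, x = (p * b) ⊗ₜ[K] q - p ⊗ₜ[K] (b * q)}

/-- The tensor product `P ⊗_B P` over a (not necessarily commutative) subalgebra `B` of `P`. -/
abbrev BalancedTensor {K P : Type*} [CommRing K] [Ring P] [Algebra K P] (B : Subalgebra K P) :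
    Type _ :=
  (P ⊗[K] P) ⧸ balancedRelations B

namespace RightCoaction

variable {K C P : Type*} [CommRing K] [AddCommGroup C] [Module K C] [Coalgebra K C]
  [Ring P] [Algebra K P]

/-- The subalgebra `P^{co C}` of coinvariants: all `b` with `ρ(b p) = b ρ(p)` for every `p`. -/
def coinvariants (δ : RightCoaction K C P) : Subalgebra K P where
  carrier := {b | ∀ p, δ.coact (b * p) = b • δ.coact p}
  mul_mem' {a b} ha hb p := by rw [mul_assoc, ha, hb, mul_smul]
  add_mem' {a b} ha hb p := by rw [add_mul, map_add, ha, hb, add_smul]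
  algebraMap_mem' k p := by rw [← Algebra.smul_def, map_smul, algebraMap_smul]

/-- The map `P ⊗_K P → P ⊗ C`, `p ⊗ q ↦ p q₍₀₎ ⊗ q₍₁₎`. -/
def preCan (δ : RightCoaction K C P) : P ⊗[K] P →ₗ[K] P ⊗[K] C :=
  (LinearMap.mul' K P).rTensor C ∘ₗ (TensorProduct.assoc K P P C).symm.toLinearMap ∘ₗ
    δ.coact.lTensor P

theorem preCan_tmul (δ : RightCoaction K C P) (p q : P) :
    δ.preCan (p ⊗ₜ[K] q) = p • δ.coact q := by
  have h : ∀ z : P ⊗[K] C, (LinearMap.mul' K P).rTensor C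
      ((TensorProduct.assoc K P P C).symm (p ⊗ₜ[K] z)) = p • z := by
    intro z
    induction z with
    | zero => simp
    | tmul x y => simp [TensorProduct.smul_tmul']
    | add x y hx hy => rw [TensorProduct.tmul_add, map_add, map_add, hx, hy, smul_add]
  simpa [preCan] using h (δ.coact q)

theorem balancedRelations_le_ker_preCan (δ : RightCoaction K C P) :
    balancedRelations δ.coinvariants ≤ LinearMap.ker δ.preCan := by
  refine Submodule.span_le.2 ?_
  rintro _ ⟨p, b, hb, q, rfl⟩
  rw [SetLike.mem_coe, LinearMap.mem_ker, map_sub, preCan_tmul, preCan_tmul, hb q, mul_smul,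
    sub_self]

/-- The canonical map `P ⊗_B P → P ⊗ C`, `p ⊗_B q ↦ p q₍₀₎ ⊗ q₍₁₎`, where `B = P^{co C}`. -/
def can (δ : RightCoaction K C P) : BalancedTensor δ.coinvariants →ₗ[K] P ⊗[K] C :=
  (balancedRelations δ.coinvariants).liftQ δ.preCan δ.balancedRelations_le_ker_preCan

/-- `P` is a `C`-coalgebra Galois extension of `P^{co C}`. -/
def IsCoalgebraGalois (δ : RightCoaction K C P) : Prop :=
  Function.Bijective δ.can

/-- A cleaving map: a right `C`-colinear map `γ : C → P` that is a unit of the convolution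
algebra `Hom_K(C, P)`. -/
structure CleavingMap (δ : RightCoaction K C P) where
  /-- the map `γ` together with its convolution inverse -/
  unit : (WithConv (C →ₗ[K] P))ˣ
  colinear : δ.coact ∘ₗ (unit : WithConv (C →ₗ[K] P)).ofConv =
    (unit : WithConv (C →ₗ[K] P)).ofConv.rTensor C ∘ₗ Coalgebra.comul

namespace CleavingMap

variable {δ : RightCoaction K C P}

/-- The underlying linear map `γ : C → P`. -/
def toLinearMap (γ : CleavingMap δ) : C →ₗ[K] P := (γ.unit : WithConv (C →ₗ[K] P)).ofConv

/-- The convolution inverse `γ⁻¹ : C → P`. -/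
def inv (γ : CleavingMap δ) : C →ₗ[K] P := (↑γ.unit⁻¹ : WithConv (C →ₗ[K] P)).ofConv

/-- The element `1₍₀₎ γ⁻¹(1₍₁₎)` of `P`. -/
def unitElement (γ : CleavingMap δ) : P :=
  LinearMap.mul' K P (γ.inv.lTensor P (δ.coact 1))

end CleavingMap

/-- `N` is a right `C`-subcomodule: `ρ(N)` lies in the image of `N ⊗ C` in `P ⊗ C`. -/
def IsSubcomodule (δ : RightCoaction K C P) (N : Submodule K P) : Prop :=
  ∀ n ∈ N, δ.coact n ∈ LinearMap.range (N.subtype.rTensor C)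

/-- A two-sided ideal of `P` which is also a right `C`-subcomodule. -/
structure InvariantIdeal (δ : RightCoaction K C P) where
  /-- the ideal -/
  ideal : Ideal P
  isTwoSided : ideal.IsTwoSided
  isSubcomodule : δ.IsSubcomodule (ideal.restrictScalars K)

namespace InvariantIdeal

variable {δ : RightCoaction K C P}

instance (J : InvariantIdeal δ) : J.ideal.IsTwoSided := J.isTwoSided

/-- The sum `J + L`. -/
protected def add (J L : InvariantIdeal δ) : InvariantIdeal δ where
  ideal := J.ideal ⊔ L.ideal
  isTwoSided := ⟨fun {a} b ha => by
    obtain ⟨x, hx, y, hy, rfl⟩ := Submodule.mem_sup.1 ha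
    rw [add_mul]
    exact Submodule.add_mem_sup (J.ideal.mul_mem_right b hx) (L.ideal.mul_mem_right b hy)⟩
  isSubcomodule := by
    have mono : ∀ {N N' : Submodule K P}, N ≤ N' →
        LinearMap.range (N.subtype.rTensor C) ≤ LinearMap.range (N'.subtype.rTensor C) := by
      intro N N' h
      rw [← Submodule.subtype_comp_inclusion N N' h, LinearMap.rTensor_comp]
      exact LinearMap.range_comp_le_range _ _
    intro n hn
    obtain ⟨x, hx, y, hy, rfl⟩ := Submodule.mem_sup.1 (show n ∈ J.ideal ⊔ L.ideal from hn)
    rw [map_add]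
    exact Submodule.add_mem _
      (mono (fun _ h => (le_sup_left : J.ideal ≤ J.ideal ⊔ L.ideal) h) (J.isSubcomodule x hx))
      (mono (fun _ h => (le_sup_right : L.ideal ≤ J.ideal ⊔ L.ideal) h) (L.isSubcomodule y hy))

instance : Add (InvariantIdeal δ) := ⟨InvariantIdeal.add⟩

theorem ideal_add (J L : InvariantIdeal δ) : (J + L).ideal = J.ideal ⊔ L.ideal := rfl

/-- The quotient algebra `P / J`. -/
abbrev QuotAlg (J : InvariantIdeal δ) : Type _ := P ⧸ J.ideal

/-- The canonical surjection `P → P / J`. -/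
abbrev proj (J : InvariantIdeal δ) : P →ₐ[K] J.QuotAlg := Ideal.Quotient.mkₐ K J.ideal

/-- The canonical surjection `P / J → P / (J + L)`. -/
abbrev toSumLeft (J L : InvariantIdeal δ) : J.QuotAlg →ₐ[K] (J + L).QuotAlg :=
  Ideal.Quotient.factorₐ K (show J.ideal ≤ (J + L).ideal from le_sup_left)

/-- The canonical surjection `P / L → P / (J + L)`. -/
abbrev toSumRight (J L : InvariantIdeal δ) : L.QuotAlg →ₐ[K] (J + L).QuotAlg :=
  Ideal.Quotient.factorₐ K (show L.ideal ≤ (J + L).ideal from le_sup_right)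

theorem proj_rTensor_coact (J : InvariantIdeal δ) :
    J.ideal.restrictScalars K ≤
      LinearMap.ker (J.proj.toLinearMap.rTensor C ∘ₗ δ.coact) := by
  intro n hn
  obtain ⟨z, hz⟩ := J.isSubcomodule n hn
  have h0 : J.proj.toLinearMap ∘ₗ (J.ideal.restrictScalars K).subtype = 0 := by
    ext x
    exact Ideal.Quotient.eq_zero_iff_mem.2 x.2
  rw [LinearMap.mem_ker, LinearMap.comp_apply, ← hz, ← LinearMap.comp_apply,
    ← LinearMap.rTensor_comp, h0, LinearMap.rTensor_zero, LinearMap.zero_apply]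

/-- The induced map `P / J → (P / J) ⊗ C`. -/
def quotCoact (J : InvariantIdeal δ) : J.QuotAlg →ₗ[K] J.QuotAlg ⊗[K] C :=
  (J.ideal.restrictScalars K).liftQ (J.proj.toLinearMap.rTensor C ∘ₗ δ.coact)
      J.proj_rTensor_coact ∘ₗ
    (Submodule.Quotient.restrictScalarsEquiv K J.ideal).symm.toLinearMap

theorem quotCoact_comp_proj (J : InvariantIdeal δ) :
    J.quotCoact ∘ₗ J.proj.toLinearMap = J.proj.toLinearMap.rTensor C ∘ₗ δ.coact := by
  ext p
  rfl

/-- The right `C`-comodule structure on `P / J` for which `P → P / J` is colinear. -/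
def coaction (J : InvariantIdeal δ) : RightCoaction K C J.QuotAlg where
  coact := J.quotCoact
  coassoc := by
    have hs : Function.Surjective J.proj.toLinearMap := Ideal.Quotient.mk_surjective
    rw [← LinearMap.cancel_right hs]
    have e1 : (TensorProduct.assoc K J.QuotAlg C C).toLinearMap ∘ₗ
        (J.proj.toLinearMap.rTensor C).rTensor C =
        J.proj.toLinearMap.rTensor (C ⊗[K] C) ∘ₗ
          (TensorProduct.assoc K P C C).toLinearMap := by
      ext p c d
      simp
    ext p
    have h1 := LinearMap.congr_fun J.quotCoact_comp_proj p
    have h2 := LinearMap.congr_fun δ.coassoc p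
    have h3 : ∀ z : P ⊗[K] C, J.quotCoact.rTensor C (J.proj.toLinearMap.rTensor C z) =
        (J.proj.toLinearMap.rTensor C).rTensor C (δ.coact.rTensor C z) := by
      intro z
      rw [← LinearMap.comp_apply, ← LinearMap.comp_apply, ← LinearMap.rTensor_comp,
        ← LinearMap.rTensor_comp, quotCoact_comp_proj]
    have h4 : ∀ z : P ⊗[K] C,
        (Coalgebra.comul (R := K) (A := C)).lTensor J.QuotAlg (J.proj.toLinearMap.rTensor C z) =
        J.proj.toLinearMap.rTensor (C ⊗[K] C) (Coalgebra.comul.lTensor P z) := by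
      intro z
      rw [← LinearMap.comp_apply, ← LinearMap.comp_apply, LinearMap.lTensor_comp_rTensor,
        LinearMap.rTensor_comp_lTensor]
    simp only [LinearMap.comp_apply] at h1 h2 ⊢
    rw [h1, h3, h4, ← h2]
    exact LinearMap.congr_fun e1 _
  counit_coact := by
    have hs : Function.Surjective J.proj.toLinearMap := Ideal.Quotient.mk_surjective
    rw [← LinearMap.cancel_right hs]
    ext p
    have h1 := LinearMap.congr_fun J.quotCoact_comp_proj p
    have h2 := LinearMap.congr_fun δ.counit_coact p
    have e1 : (TensorProduct.rid K J.QuotAlg).toLinearMap ∘ₗ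
        (Coalgebra.counit (R := K) (A := C)).lTensor J.QuotAlg ∘ₗ J.proj.toLinearMap.rTensor C =
        J.proj.toLinearMap ∘ₗ (TensorProduct.rid K P).toLinearMap ∘ₗ
          (Coalgebra.counit (R := K) (A := C)).lTensor P := by
      ext p c
      simp only [TensorProduct.AlgebraTensorModule.curry_apply, TensorProduct.curry_apply, LinearMap.coe_restrictScalars, LinearMap.comp_apply, LinearMap.rTensor_tmul, LinearMap.lTensor_tmul, LinearEquiv.coe_coe, TensorProduct.rid_tmul, map_smul]
    simp only [LinearMap.comp_apply] at h1 h2 ⊢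
    rw [h1]
    refine (LinearMap.congr_fun e1 _).trans ?_
    exact congrArg J.proj.toLinearMap h2

end InvariantIdeal

variable {δ : RightCoaction K C P} {ι : Type*}

/-- `(Jᵢ)` is a complete covering of `P`: the `Jᵢ` intersect in `0`, and `P` maps onto the
families `(mᵢ)` in `∏ᵢ P / Jᵢ` with `mᵢ`, `mⱼ` agreeing in `P / (Jᵢ + Jⱼ)` for all `i`, `j`. -/
structure IsCompleteCovering (J : ι → InvariantIdeal δ) : Prop where
  iInf_eq_bot : ⨅ i, (J i).ideal = ⊥
  exists_lift : ∀ m : ∀ i, (J i).QuotAlg,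
    (∀ i j, (J i).toSumLeft (J j) (m i) = (J i).toSumRight (J j) (m j)) →
      ∃ p : P, ∀ i, (J i).proj p = m i

/-- `P`, with `B = P^{co C}` and the finite family `(Jᵢ)`, is a locally `C`-coalgebra Galois
extension. -/
structure IsLocallyGalois [Finite ι] (J : ι → InvariantIdeal δ) : Prop where
  isCompleteCovering : IsCompleteCovering J
  map_coinvariants : ∀ i, δ.coinvariants.map (J i).proj = (J i).coaction.coinvariants
  isCoalgebraGalois : ∀ i, (J i).coaction.IsCoalgebraGalois
  map_coinvariants_add : ∀ i j,
    δ.coinvariants.map (J i + J j).proj = (J i + J j).coaction.coinvariants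

/-- The ideal `B ∩ J` of `B = P^{co C}`. -/
abbrev baseIdeal (J : InvariantIdeal δ) : Ideal δ.coinvariants :=
  J.ideal.comap δ.coinvariants.val

/-- The quotient `B / (B ∩ J)`. -/
abbrev BaseQuot (J : InvariantIdeal δ) : Type _ := δ.coinvariants ⧸ baseIdeal J

/-- The canonical embedding `B / (B ∩ J) → P / J`. -/
def baseEmbedding (J : InvariantIdeal δ) : BaseQuot J →ₐ[K] J.QuotAlg :=
  Ideal.quotientMapₐ J.ideal δ.coinvariants.val le_rfl

/-- The canonical surjection `π : B / (B ∩ J) → B / (B ∩ J + B ∩ L)`. -/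
def baseProj (J L : InvariantIdeal δ) :
    BaseQuot J →ₗ[K] δ.coinvariants ⧸ (baseIdeal J ⊔ baseIdeal L) :=
  (Submodule.factor (le_sup_left : baseIdeal J ≤ baseIdeal J ⊔ baseIdeal L)).restrictScalars K

/-- The kernel of `B / (B ∩ J) → B / (B ∩ J + B ∩ L)`, regarded as a subspace of `P / J`. -/
def baseKer (J L : InvariantIdeal δ) : Submodule K J.QuotAlg :=
  (LinearMap.ker (baseProj J L)).map (baseEmbedding J).toLinearMap

/-- A locally Galois extension with chosen cleaving maps `γᵢ : C → P / Jᵢ` (that is, a locally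
cleft extension) is regular if each `1₍₀₎ γᵢ⁻¹(1₍₁₎)` has a right inverse in `B / (B ∩ Jᵢ)`. -/
structure IsRegularLocallyCleft [Finite ι] (J : ι → InvariantIdeal δ)
    (γ : ∀ i, CleavingMap (J i).coaction) : Prop where
  isLocallyGalois : IsLocallyGalois J
  exists_right_inv : ∀ i, ∃ y : BaseQuot (J i), (γ i).unitElement * baseEmbedding (J i) y = 1

end RightCoaction

end

/-! Write `J`, `L` for the two ideals and `B` for the coinvariants. Since `J ∩ L = 0`, also `JL = LJ
= 0`, and `J` embeds in `P / L`. So `P` is glued from `P / J` and from `J`, and `J` is controlled by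
the cleft extension `P / L`.

In a cleft Galois extension, `p = r(p₍₀₎) γ(p₍₁₎)` with `r(p) = p₍₀₎ γ⁻¹(p₍₁₎)` coinvariant
(`retract_mem_coinvariants`), and `c ↦ γ⁻¹(c₍₁₎) ⊗ γ(c₍₂₎)` gives a right inverse of the canonical
map. Applied in `P / L` to the image of `J`, the decomposition yields `J = (B ∩ J) P`
(`ideal_le_span_coinvariants`). By symmetry `L = (B ∩ L) P`, so every `j ⊗ l` vanishes in `P ⊗_B P`.

Lifting the translation map of `P / L` along a linear section gives `liftCanInv`. Errors of lifting
lie in `L`, so after multiplication by `J` they disappear: on `J ⊗ C` it is a right inverse of the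
canonical map, and on `J ⊗ P` a left inverse modulo the relations. Bijectivity for `P / J` reduces
both injectivity and surjectivity for `P` to these two pieces. -/

noncomputable section

namespace RightCoaction

/-- The regular coaction of a coalgebra on itself. -/
def regular (K C : Type*) [CommRing K] [AddCommGroup C] [Module K C] [Coalgebra K C] :
    RightCoaction K C C where
  coact := Coalgebra.comul
  coassoc := Coalgebra.coassoc
  counit_coact := by
    ext c
    simp

/-! ### Coassociativity in Sweedler form -/

section Sweedler

variable {K C M N : Type*} [CommRing K] [AddCommGroup C] [Module K C] [Coalgebra K C]
  [AddCommGroup M] [Module K M] [AddCommGroup N] [Module K N]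

/-- Coassociativity in Sweedler style: if `F (m ⊗ c)` is the value of `T` at
`m₍₀₎ ⊗ m₍₁₎ ⊗ c` and `G (m ⊗ c)` is the value of `T` at `m ⊗ c₍₁₎ ⊗ c₍₂₎`, then `F` and `G`
agree on every `m₍₀₎ ⊗ m₍₁₎`. -/
theorem apply_coact_eq_of_coassoc (δ : RightCoaction K C M) (F G : M ⊗[K] C →ₗ[K] N)
    (T : M ⊗[K] (C ⊗[K] C) →ₗ[K] N)
    (hF : ∀ m c, F (m ⊗ₜ c) = T (TensorProduct.assoc K M C C (δ.coact m ⊗ₜ c)))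
    (hG : ∀ m c, G (m ⊗ₜ c) = T (m ⊗ₜ Coalgebra.comul c)) (m : M) :
    F (δ.coact m) = G (δ.coact m) := by
  have h1 : F = T ∘ₗ (TensorProduct.assoc K M C C).toLinearMap ∘ₗ δ.coact.rTensor C :=
    TensorProduct.ext' fun m c => by simpa using hF m c
  have h2 : G = T ∘ₗ (Coalgebra.comul (R := K) (A := C)).lTensor M :=
    TensorProduct.ext' fun m c => by simpa using hG m c
  rw [h1, h2]
  exact congrArg T (LinearMap.congr_fun δ.coassoc m)

theorem rid_lTensor_counit_coact (δ : RightCoaction K C M) (m : M) :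
    TensorProduct.rid K M ((Coalgebra.counit (R := K) (A := C)).lTensor M (δ.coact m)) = m :=
  LinearMap.congr_fun δ.counit_coact m

end Sweedler

variable {K C Q : Type*} [CommRing K] [AddCommGroup C] [Module K C] [Coalgebra K C]
  [Ring Q] [Algebra K Q]

/-- The action `q ⊗ m ↦ q m` of an algebra on a left module. -/
def actionMap (K Q M : Type*) [CommRing K] [Ring Q] [Algebra K Q] [AddCommGroup M] [Module K M]
    [Module Q M] [IsScalarTower K Q M] : Q ⊗[K] M →ₗ[K] M :=
  TensorProduct.lift (Algebra.lsmul K K M).toLinearMap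

@[simp]
theorem actionMap_tmul {M : Type*} [AddCommGroup M] [Module K M] [Module Q M]
    [IsScalarTower K Q M] (q : Q) (m : M) : actionMap K Q M (q ⊗ₜ m) = q • m := rfl

variable (δ : RightCoaction K C Q)

theorem preCan_smul (a : Q) (z : Q ⊗[K] Q) : δ.preCan (a • z) = a • δ.preCan z := by
  induction z with
  | zero => simp
  | tmul x y => rw [TensorProduct.smul_tmul', preCan_tmul, preCan_tmul, smul_eq_mul, mul_smul]
  | add x y hx hy => rw [smul_add, map_add, hx, hy, map_add, smul_add]

theorem mem_balancedRelations_of_preCan_eq_zero (h : Function.Injective δ.can) {z : Q ⊗[K] Q}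
    (hz : δ.preCan z = 0) : z ∈ balancedRelations δ.coinvariants := by
  rw [← Submodule.Quotient.mk_eq_zero]
  exact h (hz.trans (map_zero _).symm)

/-! ### Cleft Galois extensions: translation map and coinvariant retraction -/

namespace CleavingMap

variable {δ} (γ : CleavingMap δ)

theorem mul'_map_inv (c : C) :
    LinearMap.mul' K Q (TensorProduct.map γ.inv γ.toLinearMap (Coalgebra.comul c)) =
      algebraMap K Q (Coalgebra.counit c) :=
  LinearMap.congr_fun (congrArg WithConv.ofConv γ.unit.inv_mul) c

theorem mul'_map_toLinearMap (c : C) :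
    LinearMap.mul' K Q (TensorProduct.map γ.toLinearMap γ.inv (Coalgebra.comul c)) =
      algebraMap K Q (Coalgebra.counit c) :=
  LinearMap.congr_fun (congrArg WithConv.ofConv γ.unit.mul_inv) c

theorem coact_apply (c : C) :
    δ.coact (γ.toLinearMap c) = γ.toLinearMap.rTensor C (Coalgebra.comul c) :=
  LinearMap.congr_fun γ.colinear c

/-- The translation map `c ↦ γ⁻¹(c₍₁₎) ⊗ γ(c₍₂₎)`. -/
def translation : C →ₗ[K] Q ⊗[K] Q :=
  TensorProduct.map γ.inv γ.toLinearMap ∘ₗ Coalgebra.comul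

/-- By colinearity of `γ` the left side is `γ⁻¹(c₍₁₎) γ(c₍₂₎) ⊗ c₍₃₎`, and the convolution product
collapses to the counit. -/
theorem preCan_translation (c : C) : δ.preCan (γ.translation c) = 1 ⊗ₜ c := by
  have h := (regular K C).apply_coact_eq_of_coassoc
    ((LinearMap.mul' K Q ∘ₗ TensorProduct.map γ.inv γ.toLinearMap ∘ₗ
      Coalgebra.comul).rTensor C)
    (δ.preCan ∘ₗ TensorProduct.map γ.inv γ.toLinearMap)
    ((LinearMap.mul' K Q).rTensor C ∘ₗ (TensorProduct.assoc K Q Q C).symm.toLinearMap ∘ₗ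
      TensorProduct.map γ.inv (γ.toLinearMap.rTensor C))
    (fun c d => ?_) (fun c d => ?_) c
  · refine h.symm.trans ?_
    have e : LinearMap.mul' K Q ∘ₗ TensorProduct.map γ.inv γ.toLinearMap ∘ₗ Coalgebra.comul =
        Algebra.linearMap K Q ∘ₗ Coalgebra.counit := LinearMap.ext γ.mul'_map_inv
    rw [e, LinearMap.rTensor_comp, LinearMap.comp_apply]
    refine (congrArg _ (Coalgebra.rTensor_counit_comul c)).trans ?_
    simp
  · simp only [regular, LinearMap.rTensor_tmul, LinearMap.comp_apply]
    induction Coalgebra.comul (R := K) c with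
    | zero => simp
    | tmul x y => simp
    | add x y hx hy =>
      simp only [TensorProduct.add_tmul, map_add] at hx hy ⊢
      rw [hx, hy]
  · simp [preCan, coact_apply]

/-- The map `p ↦ p₍₀₎ γ⁻¹(p₍₁₎)`. -/
def retract : Q →ₗ[K] Q := LinearMap.mul' K Q ∘ₗ γ.inv.lTensor Q ∘ₗ δ.coact

/-- `p₍₀₎ γ⁻¹(p₍₁₎) γ(p₍₂₎) = p`. -/
theorem mul'_map_retract_coact (p : Q) :
    LinearMap.mul' K Q (TensorProduct.map γ.retract γ.toLinearMap (δ.coact p)) = p := by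
  refine (δ.apply_coact_eq_of_coassoc
    (LinearMap.mul' K Q ∘ₗ TensorProduct.map γ.retract γ.toLinearMap)
    ((TensorProduct.rid K Q).toLinearMap ∘ₗ (Coalgebra.counit (R := K) (A := C)).lTensor Q)
    (LinearMap.mul' K Q ∘ₗ LinearMap.lTensor Q (LinearMap.mul' K Q ∘ₗ
      TensorProduct.map γ.inv γ.toLinearMap)) (fun q c => ?_) (fun q c => ?_) p).trans
    (δ.rid_lTensor_counit_coact p)
  · simp only [LinearMap.comp_apply, TensorProduct.map_tmul, retract]
    induction δ.coact q with
    | zero => simp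
    | tmul x y => simp [mul_assoc]
    | add x y hx hy =>
      simp only [TensorProduct.add_tmul, map_add] at hx hy ⊢
      rw [hx, hy]
  · simp [mul'_map_inv, Algebra.smul_def, Algebra.commutes]

/-- `p₍₀₎ γ⁻¹(p₍₁₎) ⊗ γ(p₍₂₎)`, computed from the translation map. -/
theorem actionMap_translation_coact (p : Q) :
    actionMap K Q (Q ⊗[K] Q) (γ.translation.lTensor Q (δ.coact p)) =
      TensorProduct.map γ.retract γ.toLinearMap (δ.coact p) := by
  refine (δ.apply_coact_eq_of_coassoc
    (TensorProduct.map γ.retract γ.toLinearMap)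
    (actionMap K Q (Q ⊗[K] Q) ∘ₗ γ.translation.lTensor Q)
    (actionMap K Q (Q ⊗[K] Q) ∘ₗ (TensorProduct.map γ.inv γ.toLinearMap).lTensor Q)
    (fun q c => ?_) (fun q c => ?_) p).symm
  · simp only [LinearMap.comp_apply, TensorProduct.map_tmul, retract]
    induction δ.coact q with
    | zero => simp
    | tmul x y => simp [TensorProduct.smul_tmul']
    | add x y hx hy =>
      simp only [TensorProduct.add_tmul, map_add] at hx hy ⊢
      rw [hx, hy]
  · simp [translation]

theorem preCan_actionMap_translation (z : Q ⊗[K] C) :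
    δ.preCan (actionMap K Q (Q ⊗[K] Q) (γ.translation.lTensor Q z)) = z := by
  induction z with
  | zero => simp
  | tmul x y => simp [preCan_smul, preCan_translation, TensorProduct.smul_tmul']
  | add x y hx hy => rw [map_add, map_add, map_add, hx, hy]

/-- If `can` is injective, then `ρ(p q) = p₍₀₎ γ⁻¹(p₍₁₎) ρ(γ(p₍₂₎) q)`. -/
theorem coact_mul (h : Function.Injective δ.can) (p q : Q) :
    δ.coact (p * q) = actionMap K Q (Q ⊗[K] C) (TensorProduct.map γ.retract
      (δ.coact ∘ₗ LinearMap.mulRight K q ∘ₗ γ.toLinearMap) (δ.coact p)) := by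
  -- Both tensors are sent to `ρ(p)` by `preCan`, so injectivity of `can` identifies them over the
  -- coinvariants.
  have h1 : (1 : Q) ⊗ₜ[K] p - TensorProduct.map γ.retract γ.toLinearMap (δ.coact p) ∈
      balancedRelations δ.coinvariants := by
    apply δ.mem_balancedRelations_of_preCan_eq_zero h
    rw [map_sub, ← actionMap_translation_coact, preCan_actionMap_translation, preCan_tmul,
      one_smul, sub_self]
  -- The map `a ⊗ a' ↦ a ρ(a' q)` is balanced over the coinvariants; evaluating it on `h1` gives the
  -- formula.
  have h2 : balancedRelations δ.coinvariants ≤ LinearMap.ker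
      (actionMap K Q (Q ⊗[K] C) ∘ₗ (δ.coact ∘ₗ LinearMap.mulRight K q).lTensor Q) := by
    refine Submodule.span_le.2 ?_
    rintro _ ⟨a, b, hb, a', rfl⟩
    simp [mul_assoc, hb (a' * q), mul_smul]
  have h3 := h2 h1
  rw [LinearMap.mem_ker, map_sub, sub_eq_zero] at h3
  simp only [LinearMap.comp_apply, LinearMap.lTensor_tmul, LinearMap.mulRight_apply,
    actionMap_tmul, one_smul] at h3
  rw [h3, ← LinearMap.comp_apply (LinearMap.lTensor _ _), LinearMap.lTensor_comp_map]
  rfl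

/-- `p₍₀₎ γ⁻¹(p₍₁₎)` is coinvariant if `can` is injective. -/
theorem retract_mem_coinvariants (h : Function.Injective δ.can) (p : Q) :
    γ.retract p ∈ δ.coinvariants := by
  intro q
  -- Both sides equal `r(p₍₀₎) ρ(γ(p₍₁₎) γ⁻¹(p₍₂₎) q)` with `r = γ.retract`: one by `coact_mul`, the
  -- other because `γ * γ⁻¹` is the convolution unit.
  refine (δ.apply_coact_eq_of_coassoc
    (δ.coact ∘ₗ LinearMap.mulRight K q ∘ₗ LinearMap.mul' K Q ∘ₗ γ.inv.lTensor Q)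
    ((LinearMap.toSpanSingleton Q _ (δ.coact q)).restrictScalars K ∘ₗ γ.retract ∘ₗ
      (TensorProduct.rid K Q).toLinearMap ∘ₗ (Coalgebra.counit (R := K) (A := C)).lTensor Q)
    (actionMap K Q (Q ⊗[K] C) ∘ₗ TensorProduct.map γ.retract
      (δ.coact ∘ₗ LinearMap.mulRight K q ∘ₗ LinearMap.mul' K Q ∘ₗ
        TensorProduct.map γ.toLinearMap γ.inv)) (fun x c => ?_) (fun x c => ?_) p).trans ?_
  · simp only [LinearMap.comp_apply, LinearMap.lTensor_tmul, LinearMap.mul'_apply,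
      LinearMap.mulRight_apply, mul_assoc]
    rw [γ.coact_mul h]
    induction δ.coact x with
    | zero => simp
    | tmul x y => simp [mul_assoc]
    | add x y hx hy =>
      simp only [TensorProduct.add_tmul, map_add] at hx hy ⊢
      rw [hx, hy]
  · simp [mul'_map_toLinearMap, ← Algebra.smul_def]
  · simp [δ.rid_lTensor_counit_coact p]

end CleavingMap

end RightCoaction

/-- If `f` and `g` are jointly injective, then so are `f ⊗ N` and `g ⊗ N` over a field. -/
theorem LinearMap.eq_zero_of_rTensor_eq_zero {K M M₁ M₂ N : Type*} [Field K] [AddCommGroup M]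
    [Module K M] [AddCommGroup M₁] [Module K M₁] [AddCommGroup M₂] [Module K M₂] [AddCommGroup N]
    [Module K N] {f : M →ₗ[K] M₁} {g : M →ₗ[K] M₂}
    (hfg : ∀ m, f m = 0 → g m = 0 → m = 0) {z : M ⊗[K] N} (hf : f.rTensor N z = 0)
    (hg : g.rTensor N z = 0) : z = 0 := by
  have hinj : Function.Injective (f.prod g) := by
    rw [← LinearMap.ker_eq_bot, LinearMap.ker_eq_bot']
    intro m hm
    exact hfg m (congrArg Prod.fst hm) (congrArg Prod.snd hm)
  -- The pair `(f, g)` is injective, and flatness over a field keeps it so after tensoring.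
  apply Module.Flat.rTensor_preserves_injective_linearMap (M := N) _ hinj
  apply (TensorProduct.prodLeft K K M₁ M₂ N).injective
  have h : ∀ z : M ⊗[K] N, TensorProduct.prodLeft K K M₁ M₂ N ((f.prod g).rTensor N z) =
      (f.rTensor N z, g.rTensor N z) := by
    intro z
    induction z with
    | zero => simp only [map_zero]; rfl
    | tmul x y => simp
    | add x y hx hy => simp [hx, hy]
  rw [h, hf, hg]
  simp

namespace RightCoaction

/-! ### Quotients by invariant ideals, and ideals generated by coinvariants -/

namespace InvariantIdeal

section

variable {K C P : Type*} [CommRing K] [AddCommGroup C] [Module K C] [Coalgebra K C]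
  [Ring P] [Algebra K P] {δ : RightCoaction K C P} (J L : InvariantIdeal δ)

theorem proj_eq_zero_iff {p : P} : J.proj p = 0 ↔ p ∈ J.ideal := Ideal.Quotient.eq_zero_iff_mem

theorem proj_surjective : Function.Surjective J.proj := Ideal.Quotient.mk_surjective

theorem exact_subtype_proj :
    Function.Exact (J.ideal.restrictScalars K).subtype J.proj.toLinearMap := by
  intro p
  refine (proj_eq_zero_iff J).trans ?_
  simp

theorem rTensor_proj_eq_zero_iff {z : P ⊗[K] C} : J.proj.toLinearMap.rTensor C z = 0 ↔
    z ∈ LinearMap.range ((J.ideal.restrictScalars K).subtype.rTensor C) :=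
  rTensor_exact C J.exact_subtype_proj J.proj_surjective z

theorem coaction_proj (p : P) :
    J.coaction.coact (J.proj p) = J.proj.toLinearMap.rTensor C (δ.coact p) := rfl

theorem rTensor_proj_smul (p : P) (z : P ⊗[K] C) :
    J.proj.toLinearMap.rTensor C (p • z) = J.proj p • J.proj.toLinearMap.rTensor C z := by
  induction z with
  | zero => simp
  | tmul x y => simp [TensorProduct.smul_tmul']
  | add x y hx hy => rw [smul_add, map_add, hx, hy, map_add, smul_add]

theorem preCan_map_proj (z : P ⊗[K] P) :
    J.coaction.preCan (TensorProduct.map J.proj.toLinearMap J.proj.toLinearMap z) =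
      J.proj.toLinearMap.rTensor C (δ.preCan z) := by
  induction z with
  | zero => simp
  | tmul x y =>
    rw [TensorProduct.map_tmul, preCan_tmul, preCan_tmul, rTensor_proj_smul]
    rfl
  | add x y hx hy => simp only [map_add, hx, hy]

/-- Coinvariants of `P / J` lift to coinvariants of `P`, so each generating relation lifts. -/
theorem balancedRelations_le_map
    (h : δ.coinvariants.map J.proj = J.coaction.coinvariants) :
    balancedRelations J.coaction.coinvariants ≤ (balancedRelations δ.coinvariants).map
      (TensorProduct.map J.proj.toLinearMap J.proj.toLinearMap) := by
  refine Submodule.span_le.2 ?_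
  rintro _ ⟨p, b, hb, q, rfl⟩
  rw [← h] at hb
  obtain ⟨b, hb, rfl⟩ := hb
  obtain ⟨p, rfl⟩ := J.proj_surjective p
  obtain ⟨q, rfl⟩ := J.proj_surjective q
  exact ⟨_, Submodule.subset_span ⟨p, b, hb, q, rfl⟩, by simp⟩

theorem proj_eq_iff {p q : P} : J.proj p = J.proj q ↔ p - q ∈ J.ideal := Ideal.Quotient.eq

end

section

variable {K C P : Type*} [Field K] [AddCommGroup C] [Module K C] [Coalgebra K C]
  [Ring P] [Algebra K P] {δ : RightCoaction K C P} {J L : InvariantIdeal δ}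

theorem eq_zero_of_mem_inf (hJL : J.ideal ⊓ L.ideal = ⊥) {p : P} (h1 : p ∈ J.ideal)
    (h2 : p ∈ L.ideal) : p = 0 := by
  have : p ∈ J.ideal ⊓ L.ideal := ⟨h1, h2⟩
  rwa [hJL] at this

/-- The defect `ρ(xp) - xρ(p)` vanishes modulo `J` because `x ∈ J`. It is minus the defect of `y`,
so it also vanishes modulo `L`; the two projections are jointly injective on `P ⊗ C`. -/
theorem mem_coinvariants_of_add_mem (hJL : J.ideal ⊓ L.ideal = ⊥) {x y : P}
    (hx : x ∈ J.ideal) (hy : y ∈ L.ideal) (h : x + y ∈ δ.coinvariants) :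
    x ∈ δ.coinvariants := by
  have key : ∀ (I : InvariantIdeal δ) {u : P}, u ∈ I.ideal → ∀ p,
      I.proj.toLinearMap.rTensor C (δ.coact (u * p) - u • δ.coact p) = 0 := by
    intro I u hu p
    rw [map_sub, rTensor_proj_smul, ← coaction_proj, I.proj_eq_zero_iff.2 hu,
      I.proj_eq_zero_iff.2 (I.ideal.mul_mem_right p hu)]
    simp
  intro p
  have h' : δ.coact (x * p) - x • δ.coact p = -(δ.coact (y * p) - y • δ.coact p) := by
    have := h p
    rw [add_mul, map_add, add_smul] at this
    rw [neg_sub, sub_eq_sub_iff_add_eq_add, this, add_comm]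
  rw [← sub_eq_zero]
  refine LinearMap.eq_zero_of_rTensor_eq_zero (f := J.proj.toLinearMap) (g := L.proj.toLinearMap)
    (fun m h1 h2 => eq_zero_of_mem_inf hJL (J.proj_eq_zero_iff.1 h1) (L.proj_eq_zero_iff.1 h2))
    (key J hx p) ?_
  rw [h', map_neg, key L hy p, neg_zero]

/-- If `P / L` is cleft Galois with coinvariants coming from `P` and `J ∩ L = 0`, then `J` is
generated as a right ideal by its coinvariants. -/
theorem ideal_le_span_coinvariants (hJL : J.ideal ⊓ L.ideal = ⊥)
    (hL : δ.coinvariants.map L.proj = L.coaction.coinvariants)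
    (hcan : Function.Injective L.coaction.can) (γ : CleavingMap L.coaction) {j : P}
    (hj : j ∈ J.ideal) :
    j ∈ Submodule.span K {x | ∃ k ∈ δ.coinvariants, k ∈ J.ideal ∧ ∃ p : P, x = k * p} := by
  set S := Submodule.span K {x | ∃ k ∈ δ.coinvariants, k ∈ J.ideal ∧ ∃ p : P, x = k * p} with hS
  have hSJ : S ≤ J.ideal.restrictScalars K := by
    refine Submodule.span_le.2 ?_
    rintro _ ⟨k, -, hk, p, rfl⟩
    exact J.ideal.mul_mem_right p hk
  -- The image of `J` in `P / L` is a subcomodule and an ideal, hence stable under the retraction.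
  have hret : ∀ x ∈ J.ideal, ∃ y ∈ J.ideal, L.proj y = γ.retract (L.proj x) := by
    intro x hx
    obtain ⟨z, hz⟩ := J.isSubcomodule x hx
    simp only [CleavingMap.retract, LinearMap.comp_apply, coaction_proj, ← hz]
    clear hz
    induction z with
    | zero => exact ⟨0, J.ideal.zero_mem, by simp⟩
    | tmul u c =>
      obtain ⟨g, hg⟩ := L.proj_surjective (γ.inv c)
      exact ⟨u * g, J.ideal.mul_mem_right g u.2, by simp [← hg]⟩
    | add u v hu hv =>
      obtain ⟨y, hy, hy'⟩ := hu
      obtain ⟨w, hw, hw'⟩ := hv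
      exact ⟨y + w, J.ideal.add_mem hy hw, by simp only [map_add, hy', hw']⟩
  -- The retraction also has a lift `b` in the coinvariants of `P`. Then `b = y + (b - y)` with `y ∈
  -- J` and `b - y ∈ L`, so `y` itself is coinvariant.
  have hco : ∀ x ∈ J.ideal, ∃ k ∈ δ.coinvariants, k ∈ J.ideal ∧
      L.proj k = γ.retract (L.proj x) := by
    intro x hx
    obtain ⟨y, hy, hyx⟩ := hret x hx
    have hm := γ.retract_mem_coinvariants hcan (L.proj x)
    rw [← hL] at hm
    obtain ⟨b, hb, hbx⟩ := hm
    refine ⟨y, ?_, hy, hyx⟩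
    refine mem_coinvariants_of_add_mem hJL hy (L.proj_eq_iff.1 (hbx.trans hyx.symm)) ?_
    simpa using hb
  -- As `J ∩ L = 0`, elements of `J` may be compared in `P / L`.
  suffices h : ∃ s ∈ S, L.proj s = L.proj j by
    obtain ⟨s, hs, hsj⟩ := h
    have : j - s = 0 := eq_zero_of_mem_inf hJL (J.ideal.sub_mem hj (hSJ hs))
      (L.proj_eq_iff.1 hsj.symm)
    rwa [sub_eq_zero.1 this]
  rw [← γ.mul'_map_retract_coact (L.proj j), coaction_proj]
  obtain ⟨z, hz⟩ := J.isSubcomodule j hj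
  rw [← hz]
  clear hz
  induction z with
  | zero => exact ⟨0, S.zero_mem, by simp⟩
  | tmul u c =>
    obtain ⟨g, hg⟩ := L.proj_surjective (γ.toLinearMap c)
    obtain ⟨k, hk, hkJ, hku⟩ := hco u u.2
    refine ⟨k * g, Submodule.subset_span ⟨k, hk, hkJ, g, rfl⟩, ?_⟩
    rw [map_mul, hku, hg]
    simp
  | add u v hu hv =>
    obtain ⟨y, hy, hy'⟩ := hu
    obtain ⟨w, hw, hw'⟩ := hv
    exact ⟨y + w, S.add_mem hy hw, by simp only [map_add, hy', hw']⟩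

/-- If `J` is generated as a right ideal by its coinvariants, then over the coinvariants `p ⊗ j`
with `j ∈ J` can be rewritten as a sum of `p k ⊗ q` with `k ∈ J` coinvariant. -/
theorem tmul_mem_balancedRelations_sup {j : P} (p : P)
    (hj : j ∈ Submodule.span K {x | ∃ k ∈ δ.coinvariants, k ∈ J.ideal ∧ ∃ p : P, x = k * p}) :
    p ⊗ₜ[K] j ∈ balancedRelations δ.coinvariants ⊔
      Submodule.span K {x | ∃ k ∈ δ.coinvariants, k ∈ J.ideal ∧ ∃ q : P,
        x = (p * k) ⊗ₜ[K] q} := by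
  induction hj using Submodule.span_induction with
  | mem x hx =>
    obtain ⟨k, hk, hkJ, q, rfl⟩ := hx
    have e : p ⊗ₜ[K] (k * q) = -((p * k) ⊗ₜ[K] q - p ⊗ₜ[K] (k * q)) + (p * k) ⊗ₜ[K] q := by abel
    rw [e]
    exact Submodule.add_mem_sup (neg_mem (Submodule.subset_span ⟨p, k, hk, q, rfl⟩))
      (Submodule.subset_span ⟨k, hk, hkJ, q, rfl⟩)
  | zero => simp
  | add x y _ _ hx hy => rw [TensorProduct.tmul_add]; exact add_mem hx hy
  | smul a x _ hx => rw [TensorProduct.tmul_smul]; exact Submodule.smul_mem _ a hx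

end

end InvariantIdeal

end RightCoaction

namespace RightCoaction

/-! ### Lifting the inverse of the canonical map, and gluing -/

namespace InvariantIdeal

variable {K C P : Type*} [Field K] [AddCommGroup C] [Module K C] [Coalgebra K C]
  [Ring P] [Algebra K P] {δ : RightCoaction K C P} {J L : InvariantIdeal δ}

/-- Writing `l` as a sum of `k q` with `k ∈ L` coinvariant, `j ⊗ k q` is equivalent to `j k ⊗ q`,
and `j k ∈ J ∩ L = 0`. -/
theorem tmul_mem_balancedRelations (hJL : J.ideal ⊓ L.ideal = ⊥)
    (hJ : δ.coinvariants.map J.proj = J.coaction.coinvariants)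
    (hcan : Function.Injective J.coaction.can) (γ : CleavingMap J.coaction) {j l : P}
    (hj : j ∈ J.ideal) (hl : l ∈ L.ideal) :
    j ⊗ₜ[K] l ∈ balancedRelations δ.coinvariants := by
  have h := tmul_mem_balancedRelations_sup j
    (ideal_le_span_coinvariants (inf_comm L.ideal J.ideal ▸ hJL) hJ hcan γ hl)
  refine (sup_le le_rfl (Submodule.span_le.2 ?_) :
    _ ≤ balancedRelations δ.coinvariants) h
  rintro _ ⟨k, -, hk, q, rfl⟩
  rw [eq_zero_of_mem_inf hJL (J.ideal.mul_mem_right k hj) (L.ideal.mul_mem_left j hk),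
    TensorProduct.zero_tmul]
  exact zero_mem _

variable (σ : L.QuotAlg →ₗ[K] P) (γ : CleavingMap L.coaction)

/-- The map `p ⊗ c ↦ p σ(γ⁻¹(c₍₁₎)) ⊗ σ(γ(c₍₂₎))` for a linear section `σ` of `P → P / L`. -/
def liftCanInv : P ⊗[K] C →ₗ[K] P ⊗[K] P :=
  actionMap K P (P ⊗[K] P) ∘ₗ (TensorProduct.map σ σ ∘ₗ γ.translation).lTensor P

/-- The lifted translation map satisfies `preCan_translation` modulo `L ⊗ C`, and multiplication by
`j ∈ J` annihilates that error. -/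
theorem preCan_liftCanInv (hσ : ∀ q, L.proj (σ q) = q)
    (hJL : J.ideal ⊓ L.ideal = ⊥) {j : P} (hj : j ∈ J.ideal) (c : C) :
    δ.preCan (liftCanInv σ γ (j ⊗ₜ c)) = j ⊗ₜ c := by
  have hid : L.proj.toLinearMap ∘ₗ σ = LinearMap.id := LinearMap.ext hσ
  have h : L.proj.toLinearMap.rTensor C
      (δ.preCan (TensorProduct.map σ σ (γ.translation c)) - 1 ⊗ₜ c) = 0 := by
    rw [map_sub, ← preCan_map_proj, ← LinearMap.comp_apply (TensorProduct.map _ _),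
      ← TensorProduct.map_comp, hid, TensorProduct.map_id, LinearMap.id_apply,
      γ.preCan_translation, LinearMap.rTensor_tmul]
    simp
  rw [rTensor_proj_eq_zero_iff] at h
  obtain ⟨z, hz⟩ := h
  have h0 : j • (L.ideal.restrictScalars K).subtype.rTensor C z = 0 := by
    clear hz
    induction z with
    | zero => simp
    | tmul u c =>
      rw [LinearMap.rTensor_tmul, TensorProduct.smul_tmul', smul_eq_mul, Submodule.subtype_apply,
        eq_zero_of_mem_inf hJL (J.ideal.mul_mem_right _ hj) (L.ideal.mul_mem_left j u.2),
        TensorProduct.zero_tmul]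
    | add u v hu hv => rw [map_add, smul_add, hu, hv, add_zero]
  rw [hz, smul_sub, sub_eq_zero] at h0
  simp only [liftCanInv, LinearMap.comp_apply, LinearMap.lTensor_tmul, actionMap_tmul,
    preCan_smul, h0]
  simp [TensorProduct.smul_tmul']

/-- The lifts from `P / L` are ambiguous only by elements of `L`. In the left factor these are
killed by `j`; in the right factor they contribute to `J ⊗ L`, which `hR` absorbs. -/
theorem liftCanInv_smul_coact_sub_mem (hσ : ∀ q, L.proj (σ q) = q)
    (hJL : J.ideal ⊓ L.ideal = ⊥)
    (hL : δ.coinvariants.map L.proj = L.coaction.coinvariants)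
    (hcan : Function.Injective L.coaction.can)
    (hR : ∀ j ∈ J.ideal, ∀ l ∈ L.ideal, j ⊗ₜ[K] l ∈ balancedRelations δ.coinvariants)
    {j : P} (hj : j ∈ J.ideal) (q : P) :
    liftCanInv σ γ (j • δ.coact q) - j ⊗ₜ[K] q ∈ balancedRelations δ.coinvariants := by
  have hid : L.proj.toLinearMap ∘ₗ σ = LinearMap.id := LinearMap.ext hσ
  -- a lift to `P` of the map `q ↦ q₍₀₎ γ⁻¹(q₍₁₎)`
  let E : P →ₗ[K] P := LinearMap.mul' K P ∘ₗ (σ ∘ₗ γ.inv).lTensor P ∘ₗ δ.coact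
  have hE : ∀ p, L.proj (E p) = γ.retract (L.proj p) := by
    intro p
    simp only [E, CleavingMap.retract, LinearMap.comp_apply, coaction_proj]
    induction δ.coact p with
    | zero => simp
    | tmul x c => exact (map_mul L.proj _ _).trans (congrArg _ (hσ _))
    | add x y hx hy => simp only [map_add, hx, hy]
  -- A lift of `p ⊗ c ↦ r(p) γ(c)`, with `r = γ.retract`; on `ρ(q)` it returns `q` modulo `L`
  -- (`h3`).
  let T : P ⊗[K] C →ₗ[K] P :=
    LinearMap.mul' K P ∘ₗ TensorProduct.map (σ ∘ₗ γ.retract ∘ₗ L.proj.toLinearMap)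
      (σ ∘ₗ γ.toLinearMap)
  have h1 : liftCanInv σ γ (j • δ.coact q) =
      TensorProduct.map (LinearMap.mulLeft K j ∘ₗ E) (σ ∘ₗ γ.toLinearMap) (δ.coact q) := by
    refine Eq.trans ?_ (δ.apply_coact_eq_of_coassoc
      (TensorProduct.map (LinearMap.mulLeft K j ∘ₗ E) (σ ∘ₗ γ.toLinearMap))
      (liftCanInv σ γ ∘ₗ (LinearMap.mulLeft K j).rTensor C)
      (actionMap K P (P ⊗[K] P) ∘ₗ TensorProduct.map (LinearMap.mulLeft K j)
        (TensorProduct.map (σ ∘ₗ γ.inv) (σ ∘ₗ γ.toLinearMap)))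
      (fun x c => ?_) (fun x c => ?_) q).symm
    · rw [LinearMap.comp_apply]
      refine congrArg _ ?_
      induction δ.coact q with
      | zero => simp
      | tmul x y => simp [TensorProduct.smul_tmul']
      | add x y hx hy => rw [smul_add, map_add, hx, hy]
    · simp only [LinearMap.comp_apply, TensorProduct.map_tmul, E]
      induction δ.coact x with
      | zero => simp
      | tmul x y => simp [TensorProduct.smul_tmul', mul_assoc]
      | add x y hx hy =>
        simp only [TensorProduct.add_tmul, map_add] at hx hy ⊢
        rw [hx, hy]
    · simp [liftCanInv, CleavingMap.translation, TensorProduct.map_comp]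
  have h2 : ∀ z : P ⊗[K] C,
      TensorProduct.map (LinearMap.mulLeft K j ∘ₗ E) (σ ∘ₗ γ.toLinearMap) z - j ⊗ₜ[K] T z ∈
        balancedRelations δ.coinvariants := by
    intro z
    induction z with
    | zero => simp
    | tmul p c =>
      -- A coinvariant lift `b` of the retraction can replace `E p` after `j`, and can then be moved
      -- across the tensor sign.
      have hm := γ.retract_mem_coinvariants hcan (L.proj p)
      rw [← hL] at hm
      obtain ⟨b, hb, hbp⟩ := hm
      replace hbp : L.proj b = γ.retract (L.proj p) := hbp
      have e1 : j * E p = j * b := by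
        rw [← sub_eq_zero, ← mul_sub]
        exact eq_zero_of_mem_inf hJL (J.ideal.mul_mem_right _ hj)
          (L.ideal.mul_mem_left j (L.proj_eq_iff.1 ((hE p).trans hbp.symm)))
      have e2 : b - σ (γ.retract (L.proj p)) ∈ L.ideal := by
        rw [← L.proj_eq_iff, hσ, hbp]
      have e3 : TensorProduct.map (LinearMap.mulLeft K j ∘ₗ E) (σ ∘ₗ γ.toLinearMap) (p ⊗ₜ c) -
            j ⊗ₜ[K] T (p ⊗ₜ c) =
          ((j * b) ⊗ₜ[K] σ (γ.toLinearMap c) - j ⊗ₜ[K] (b * σ (γ.toLinearMap c))) +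
            j ⊗ₜ[K] ((b - σ (γ.retract (L.proj p))) * σ (γ.toLinearMap c)) := by
        rw [sub_mul, TensorProduct.tmul_sub]
        simp [T, e1]
      rw [e3]
      exact add_mem (Submodule.subset_span ⟨j, b, hb, _, rfl⟩)
        (hR j hj _ (L.ideal.mul_mem_right _ e2))
    | add x y hx hy =>
      rw [map_add, map_add, TensorProduct.tmul_add, add_sub_add_comm]
      exact add_mem hx hy
  have h3 : L.proj (T (δ.coact q)) = L.proj q := by
    rw [← γ.mul'_map_retract_coact (L.proj q), coaction_proj]
    simp only [T, LinearMap.comp_apply]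
    induction δ.coact q with
    | zero => simp
    | tmul x c => exact (map_mul L.proj _ _).trans (congrArg₂ _ (hσ _) (hσ _))
    | add x y hx hy => simp only [map_add, hx, hy]
  have h4 := add_mem (h2 (δ.coact q)) (hR j hj _ (L.proj_eq_iff.1 h3))
  rw [TensorProduct.tmul_sub, sub_add_sub_cancel, ← h1] at h4
  exact h4

/-- Gluing: if `J ∩ L = 0`, and `P / J`, `P / L` are cleft coalgebra Galois extensions whose
coinvariants come from `P`, then `P` is a coalgebra Galois extension. -/
theorem isCoalgebraGalois_of_inf_eq_bot (hJL : J.ideal ⊓ L.ideal = ⊥)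
    (hJ : δ.coinvariants.map J.proj = J.coaction.coinvariants)
    (hL : δ.coinvariants.map L.proj = L.coaction.coinvariants)
    (hcanJ : J.coaction.IsCoalgebraGalois) (hcanL : L.coaction.IsCoalgebraGalois)
    (γJ : CleavingMap J.coaction) (γL : CleavingMap L.coaction) : δ.IsCoalgebraGalois := by
  obtain ⟨σ, hσ⟩ := L.proj.toLinearMap.exists_rightInverse_of_surjective
    (LinearMap.range_eq_top.2 L.proj_surjective)
  replace hσ : ∀ q, L.proj (σ q) = q := LinearMap.congr_fun hσ
  have hR : ∀ j ∈ J.ideal, ∀ l ∈ L.ideal, j ⊗ₜ[K] l ∈ balancedRelations δ.coinvariants :=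
    fun j hj l hl => tmul_mem_balancedRelations hJL hJ hcanJ.1 γJ hj hl
  constructor
  · rw [← LinearMap.ker_eq_bot]
    refine Submodule.ker_liftQ_eq_bot _ _ _ fun x hx => ?_
    rw [LinearMap.mem_ker] at hx
    -- Injectivity for `P / J` leaves, after subtracting a relation, an element of `P ⊗ J + J ⊗ P`.
    have hx1 := J.balancedRelations_le_map hJ
      (J.coaction.mem_balancedRelations_of_preCan_eq_zero hcanJ.1
        ((J.preCan_map_proj x).trans (by rw [hx, map_zero])))
    obtain ⟨r, hr, hrx⟩ := hx1
    have hker : x - r ∈ LinearMap.ker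
        (TensorProduct.map J.proj.toLinearMap J.proj.toLinearMap) := by
      rw [LinearMap.mem_ker, map_sub, hrx, sub_self]
    rw [TensorProduct.map_ker J.exact_subtype_proj J.proj_surjective J.exact_subtype_proj
      J.proj_surjective] at hker
    -- `P ⊗ J` moves into `J ⊗ P` modulo the relations, since `J` is generated on the right by its
    -- coinvariants.
    have hle : LinearMap.range ((J.ideal.restrictScalars K).subtype.lTensor P) ≤
        balancedRelations δ.coinvariants ⊔
          LinearMap.range ((J.ideal.restrictScalars K).subtype.rTensor P) := by
      rintro _ ⟨z, rfl⟩
      induction z with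
      | zero => rw [map_zero]; exact zero_mem _
      | tmul p j =>
        have hm := tmul_mem_balancedRelations_sup p
          (ideal_le_span_coinvariants hJL hL hcanL.1 γL j.2)
        revert hm
        apply sup_le_sup_left (α := Submodule K (P ⊗[K] P))
        refine Submodule.span_le.2 ?_
        rintro _ ⟨k, -, hk, q, rfl⟩
        exact ⟨⟨p * k, J.ideal.mul_mem_left p hk⟩ ⊗ₜ q, rfl⟩
      | add u v hu hv => rw [map_add]; exact add_mem hu hv
    obtain ⟨r', hr', _, ⟨y, rfl⟩, hy⟩ :=
      Submodule.mem_sup.1 ((sup_le hle le_sup_right : _ ≤ _) hker)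
    -- On `J ⊗ P` the canonical map has a left inverse modulo the relations, so the remaining part
    -- `y`, which it kills, is a relation.
    have hS : ∀ y : J.ideal.restrictScalars K ⊗[K] P,
        liftCanInv σ γL (δ.preCan ((J.ideal.restrictScalars K).subtype.rTensor P y)) -
          (J.ideal.restrictScalars K).subtype.rTensor P y ∈
            balancedRelations δ.coinvariants := by
      intro y
      induction y with
      | zero => simp
      | tmul j q =>
        rw [LinearMap.rTensor_tmul, preCan_tmul]
        exact liftCanInv_smul_coact_sub_mem σ γL hσ hJL hL hcanL.1 hR j.2 q
      | add u v hu hv =>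
        rw [map_add, map_add, map_add, add_sub_add_comm]
        exact add_mem hu hv
    have hker' := δ.balancedRelations_le_ker_preCan
    have hy0 : δ.preCan ((J.ideal.restrictScalars K).subtype.rTensor P y) = 0 := by
      have := congrArg δ.preCan hy
      rwa [map_add, map_sub, hx, LinearMap.mem_ker.1 (hker' hr), LinearMap.mem_ker.1 (hker' hr'),
        zero_add, sub_zero] at this
    have hyR := hS y
    rw [hy0, map_zero, zero_sub, neg_mem_iff] at hyR
    have := add_mem (add_mem hr' hyR) hr
    rwa [hy, sub_add_cancel] at this
  · have hsurj : Function.Surjective δ.preCan := by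
      intro z
      -- A preimage modulo `J` leaves an error in `J ⊗ C`, which `liftCanInv` corrects.
      obtain ⟨y, hy⟩ := hcanJ.2 (J.proj.toLinearMap.rTensor C z)
      obtain ⟨y, rfl⟩ := Submodule.mkQ_surjective _ y
      obtain ⟨y, rfl⟩ := TensorProduct.map_surjective (g := J.proj.toLinearMap)
        (g' := J.proj.toLinearMap) J.proj_surjective J.proj_surjective y
      replace hy : J.coaction.preCan
          (TensorProduct.map J.proj.toLinearMap J.proj.toLinearMap y) = _ := hy
      rw [preCan_map_proj, ← sub_eq_zero, ← map_sub, rTensor_proj_eq_zero_iff] at hy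
      obtain ⟨w, hw⟩ := hy
      have hw' : ∀ w, δ.preCan (liftCanInv σ γL
          ((J.ideal.restrictScalars K).subtype.rTensor C w)) =
            (J.ideal.restrictScalars K).subtype.rTensor C w := by
        intro w
        induction w with
        | zero => simp
        | tmul j c => exact preCan_liftCanInv σ γL hσ hJL j.2 c
        | add u v hu hv => simp only [map_add, hu, hv]
      refine ⟨y - liftCanInv σ γL ((J.ideal.restrictScalars K).subtype.rTensor C w), ?_⟩
      rw [map_sub, hw', hw, sub_sub_cancel]
    intro z
    obtain ⟨y, hy⟩ := hsurj z
    exact ⟨Submodule.Quotient.mk y, hy⟩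

end InvariantIdeal

end RightCoaction

end

/-- Here `J 0`, `J 1` are the two members of the covering, and products of subspaces of the algebra
`P / J 1` are spans of products. -/
theorem mainTheorem3 {K C P : Type*} [Field K] [AddCommGroup C] [Module K C] [Coalgebra K C]
    [Ring P] [Algebra K P] (δ : RightCoaction K C P)
    (J : Fin 2 → δ.InvariantIdeal)
    (γ : ∀ i, (J i).coaction.CleavingMap)
    (hreg : RightCoaction.IsRegularLocallyCleft J γ)
    (hcomm : LinearMap.range (γ 1).toLinearMap * RightCoaction.baseKer (J 1) (J 0) =
      RightCoaction.baseKer (J 1) (J 0) * LinearMap.range (γ 1).toLinearMap) :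
    δ.IsCoalgebraGalois := by
  have h := hreg.isLocallyGalois
  have hinf : (J 0).ideal ⊓ (J 1).ideal = ⊥ := by
    rw [eq_bot_iff, ← h.isCompleteCovering.iInf_eq_bot]
    exact le_iInf (Fin.forall_fin_two.2 ⟨inf_le_left, inf_le_right⟩)
  exact RightCoaction.InvariantIdeal.isCoalgebraGalois_of_inf_eq_bot hinf
    (h.map_coinvariants 0) (h.map_coinvariants 1) (h.isCoalgebraGalois 0)
    (h.isCoalgebraGalois 1) (γ 0) (γ 1)
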